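/- For every integer $d\ge 2$ put $m=\frac{d^2(d+1)^2}{4}+1$. There exists a representation (group homomorphism) $\rho:\mathsf{SL}_d(\mathbb R)\ast\mathsf{SL}_d(\mathbb R)\to\mathsf{GL}_m(\mathbb R)$, where $\ast$ is the free product of groups, with the following property. For any two discrete, finitely generated subgroups $\Gamma_1,\Gamma_2<\mathsf{SL}_d(\mathbb R)$ there exist finite-index subgroups $H_1<\Gamma_1$ and $H_2<\Gamma_2$ such that the restriction of $\rho$ to $H_1\ast H_2$ is discrete and faithful, i.e. injective with discrete image in $\mathsf{GL}_m(\mathbb R)$. In addition, for every $\varepsilon\in(0,1)$ the finite-index subgroups $H_1,H_2$ can be chosen so that, moreover, every reduced word $\gamma_1\cdots\gamma_n\in H_1\ast H_2$ (each $\gamma_i$ is a non-trivial element of one of the two factors $H_1$, $H_2$, and no two consecutive $\gamma_i$ come from the same factor) satisfies $$\frac{\sigma_1}{\sigma_m}\bigl(\rho(\gamma_1\cdots\gamma_n)\bigr)\ \ge\ \prod_{i=1}^n\left(\frac{\sigma_1}{\sigma_d}(\gamma_i)\right)^{2-\varepsilon}.$$ Here, for $g\in\mathsf{GL}_k(\mathbb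 R)$, $\sigma_1(g)\ge\cdots\ge\sigma_k(g)$ are the singular values of $g$ and $\frac{\sigma_i}{\sigma_j}(g)=\frac{\sigma_i(g)}{\sigma_j(g)}$. -/

import Mathlib

open scoped MatrixGroups

/-- The ratio `σ₁(A) / σₙ(A)` of the largest to the smallest singular value of a real `n × n`
matrix, for the Euclidean norm. Mathlib's `LinearMap.singularValues` lists the singular values in
decreasing order, starting at index `0`. -/
noncomputable def singularRatio {n : ℕ} (A : Matrix (Fin n) (Fin n) ℝ) : ℝ :=
  A.toEuclideanLin.singularValues 0 / A.toEuclideanLin.singularValues (n - 1)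

/-- A homomorphism to `GL_m(ℝ)` is discrete and faithful: it is injective and its image is a
discrete subgroup. -/
def IsDiscreteFaithful {G : Type*} [Group G] {m : ℕ} (ρ : G →* GL (Fin m) ℝ) : Prop :=
  Function.Injective ρ ∧ DiscreteTopology ρ.range

/-- The restriction of a homomorphism on `G₁ ∗ G₂` to `H₁ ∗ H₂`, for subgroups `Hᵢ` of `Gᵢ`. -/
def restrictCoprod {G₁ G₂ K : Type*} [Group G₁] [Group G₂] [Group K]
    (ρ : Monoid.Coprod G₁ G₂ →* K) (H₁ : Subgroup G₁) (H₂ : Subgroup G₂) :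
    Monoid.Coprod H₁ H₂ →* K :=
  ρ.comp (Monoid.Coprod.map H₁.subtype H₂.subtype)

/-- A word with letters in two groups is reduced if no letter is trivial and no two consecutive
letters come from the same group. -/
def IsReducedWord {G₁ G₂ : Type*} [Group G₁] [Group G₂] (w : List (G₁ ⊕ G₂)) : Prop :=
  (∀ x ∈ w, x ≠ Sum.inl 1 ∧ x ≠ Sum.inr 1) ∧ w.IsChain (fun x y => x.isLeft ≠ y.isLeft)

/-- The element of the free product `G₁ ∗ G₂` that a word represents. -/
def wordProd {G₁ G₂ : Type*} [Group G₁] [Group G₂] (w : List (G₁ ⊕ G₂)) : Monoid.Coprod G₁ G₂ :=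
  (w.map (Sum.elim Monoid.Coprod.inl Monoid.Coprod.inr)).prod

/-- The matrix underlying a letter, for words in two subgroups of `SL_d(ℝ)`. -/
def letterMatrix {d : ℕ} {H₁ H₂ : Subgroup SL(d, ℝ)} (x : H₁ ⊕ H₂) : Matrix (Fin d) (Fin d) ℝ :=
  ((Sum.elim H₁.subtype H₂.subtype x : SL(d, ℝ)) : Matrix (Fin d) (Fin d) ℝ)

/-!
The proof is a ping-pong argument for the action `S ↦ g S gᵀ` of `SL_d(ℝ)` on `M_d(ℝ)`. Extend it
trivially to `V = M_d(ℝ) × ℝ × ℝ^r`, with `r` chosen to make `dim V = m`. The first free factor acts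
on `V` in this way (`congrRep`), the second one by the conjugate under a linear involution
(`coneSwap`). If `‖g‖` is large, then `g` sends every vector close to a multiple of `(I, 1, 0)` far
into the `M_d(ℝ)` direction, to a place where the trace is positive and comparable to the norm: the
trace of `g gᵀ` is `‖g‖²` for the Frobenius norm (`InCone.congrRep`). The involution sends such
vectors back close to a multiple of `(I, 1, 0)` (`InCone.coneSwap`). Hence letters of the two factors
play ping-pong on two cones, and each letter `g` multiplies the height of a vector by at least
`‖g‖² / 2` (`exists_inCone_pingPongRep`).

A discrete group has only finitely many elements of norm below a given bound, and a finitely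
generated linear group is residually finite by Malcev's theorem, so after passing to finite-index
subgroups all nontrivial elements are as large as we please
(`exists_isFiniteRelIndex_frobenius_large`). Then nontrivial elements of `H₁ ∗ H₂` stretch one of two
fixed vectors by a definite factor, which gives injectivity and discreteness
(`isDiscreteFaithful_of_expanding`).

For singular values, the growth of a word `w` bounds `σ₁(ρ(w))` below by a constant times
`∏ ‖γᵢ‖² / 2`, and the growth of the inverse word bounds `σ_m(ρ(w))⁻¹` below by a constant times
`∏ ‖γᵢ⁻¹‖² / 2`. Since `σ₁ / σ_d (γ) ≤ ‖γ‖ ‖γ⁻¹‖`, the product of the two bounds exceeds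
`∏ (σ₁ / σ_d (γᵢ)) ^ (2 - ε)` once the constants are absorbed by the `ε`-powers of the large norms
(`mul_rpow_le_half`).
-/

/-! ### Finite-index subgroups avoiding a finite set -/

theorem isJacobsonRing_int : IsJacobsonRing ℤ := by
  rw [isJacobsonRing_iff_prime_eq]
  intro P hP
  rcases eq_or_ne P ⊥ with rfl | h
  · refine le_antisymm (fun x hx => ?_) Ideal.le_jacobson
    have hu := Int.isUnit_iff.1 (Ideal.mem_jacobson_bot.1 hx x)
    rw [Ideal.mem_bot]
    rcases hu with hu | hu <;> nlinarith [mul_self_nonneg x, sq_nonneg x]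
  · have := hP.isMaximal h
    exact Ideal.jacobson_eq_self_of_isMaximal

/-- A field that is finitely generated as a ring is finite. -/
theorem finite_of_surjective_of_finiteType_int {R K : Type*} [CommRing R] [Field K]
    [Algebra.FiniteType ℤ R] (f : R →+* K) (hf : Function.Surjective f) : Finite K := by
  have := isJacobsonRing_int
  have : Algebra.FiniteType ℤ K := Algebra.FiniteType.of_surjective f.toIntAlgHom hf
  have hfin : Module.Finite ℤ K := finite_of_finite_type_of_isJacobsonRing ℤ K
  refine Module.finite_of_fg_torsion K fun {x} => ?_
  -- otherwise `ℤ` embeds in `K`, and being integral over it, `K` forces `ℤ` to be a field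
  have hinj : ¬ Function.Injective (algebraMap ℤ K) := fun h =>
    Int.not_isField (isField_of_isIntegral_of_isField h (Field.toIsField K))
  rw [injective_iff_map_eq_zero] at hinj
  push Not at hinj
  obtain ⟨p, hp, hp0⟩ := hinj
  refine ⟨⟨p, mem_nonZeroDivisors_of_ne_zero hp0⟩, ?_⟩
  change p • x = 0
  rw [Algebra.smul_def, hp, zero_mul]

/-- A nonzero element of a finitely generated domain survives in some finite quotient field. -/
theorem exists_isMaximal_finite_quotient {R : Type*} [CommRing R] [IsDomain R]
    [Algebra.FiniteType ℤ R] {a : R} (ha : a ≠ 0) :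
    ∃ M : Ideal R, M.IsMaximal ∧ a ∉ M ∧ Finite (R ⧸ M) := by
  have := isJacobsonRing_int
  have hJ : IsJacobsonRing R := isJacobsonRing_of_finiteType (A := ℤ)
  have hbot : (⊥ : Ideal R).jacobson = ⊥ :=
    hJ.out (Ideal.IsPrime.isRadical (Ideal.isPrime_bot))
  have : a ∉ (⊥ : Ideal R).jacobson := by rw [hbot]; simpa using ha
  rw [Ideal.jacobson, Ideal.mem_sInf] at this
  push Not at this
  obtain ⟨M, ⟨-, hM⟩, haM⟩ := this
  refine ⟨M, hM, haM, ?_⟩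
  let := Ideal.Quotient.field M
  exact finite_of_surjective_of_finiteType_int (Ideal.Quotient.mk M) Ideal.Quotient.mk_surjective

theorem Matrix.SpecialLinearGroup.map_injective_of_injective {n : ℕ} {R S : Type*} [CommRing R]
    [CommRing S] {f : R →+* S} (hf : Function.Injective f) :
    Function.Injective (Matrix.SpecialLinearGroup.map (n := Fin n) f) := by
  intro g h hgh
  ext i j
  apply hf
  simpa using congrArg (fun M : SL(n, S) => M i j) hgh

/-- Malcev: a finitely generated linear group is residually finite. The group has entries in a
finitely generated ring, and the finite-index subgroup is a congruence subgroup. -/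
theorem exists_isFiniteRelIndex_disjoint {n : ℕ} {K : Type*} [Field K] (Γ : Subgroup SL(n, K))
    (hΓ : Γ.FG) {F : Set SL(n, K)} (hF : F.Finite) (h1 : 1 ∉ F) :
    ∃ H ≤ Γ, H.IsFiniteRelIndex Γ ∧ ∀ g ∈ H, g ∉ F := by
  classical
  obtain ⟨S, rfl⟩ := hΓ
  let E : Set K := ⋃ s ∈ S, Set.range fun p : Fin n × Fin n => s p.1 p.2
  have hE : E.Finite := S.finite_toSet.biUnion fun s _ => Set.finite_range _
  let R : Subalgebra ℤ K := Algebra.adjoin ℤ E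
  have : Algebra.FiniteType ℤ R :=
    (Subalgebra.fg_iff_finiteType R).1 ⟨hE.toFinset, by simp [R]⟩
  let f : SL(n, R) →* SL(n, K) := Matrix.SpecialLinearGroup.map (R.val : R →+* K)
  have hf : Function.Injective f :=
    Matrix.SpecialLinearGroup.map_injective_of_injective Subtype.val_injective
  have hΓf : Subgroup.closure (S : Set SL(n, K)) ≤ f.range := by
    rw [Subgroup.closure_le]
    intro s hs
    have hmem (i j) : s i j ∈ R :=
      Algebra.subset_adjoin (Set.mem_biUnion hs ⟨(i, j), rfl⟩)
    let A : Matrix (Fin n) (Fin n) R := fun i j => ⟨s i j, hmem i j⟩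
    have hA : (R.val : R →+* K).mapMatrix A = (s : Matrix (Fin n) (Fin n) K) := rfl
    have hdet : A.det = 1 := by
      apply Subtype.val_injective
      have := RingHom.map_det (R.val : R →+* K) A
      rw [hA, s.det_coe] at this
      exact this
    exact ⟨⟨A, hdet⟩, by ext i j; rfl⟩
  have hF' : (f ⁻¹' F).Finite := hF.preimage hf.injOn
  have hne (g : SL(n, R)) (hg : g ∈ f ⁻¹' F) : 
      ∃ p : Fin n × Fin n, g p.1 p.2 ≠ (1 : SL(n, R)) p.1 p.2 := by
    by_contra! h
    have : g = 1 := by ext i j; rw [h (i, j)]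
    rw [this] at hg
    exact h1 (by simpa using hg)
  choose p hp using hne
  let q (g : hF'.toFinset) : Fin n × Fin n := p g.1 (hF'.mem_toFinset.1 g.2)
  obtain ⟨M, hM, haM, hfin⟩ := exists_isMaximal_finite_quotient
    (a := ∏ g ∈ hF'.toFinset.attach,
      (g.1 (q g).1 (q g).2 - (1 : SL(n, R)) (q g).1 (q g).2))
    (Finset.prod_ne_zero_iff.2 fun g _ => sub_ne_zero.2 (hp g.1 (hF'.mem_toFinset.1 g.2)))
  let r : SL(n, R) →* SL(n, R ⧸ M) := Matrix.SpecialLinearGroup.map (Ideal.Quotient.mk M)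
  have : Finite SL(n, R ⧸ M) := inferInstanceAs (Finite {A : Matrix _ _ _ // A.det = 1})
  have hker : r.ker.FiniteIndex := inferInstance
  refine ⟨Subgroup.closure S ⊓ r.ker.map f, inf_le_left, ?_, ?_⟩
  · have h2 : (r.ker.map f).IsFiniteRelIndex f.range := by
      rw [Subgroup.isFiniteRelIndex_iff_relIndex_ne_zero, MonoidHom.range_eq_map,
        Subgroup.relIndex_map_map_of_injective _ _ hf, Subgroup.relIndex_top_right]
      exact hker.index_ne_zero
    have h3 := Subgroup.isFiniteRelIndex_of_le_right (r.ker.map f) hΓf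
    rw [Subgroup.isFiniteRelIndex_iff_relIndex_ne_zero] at h3 ⊢
    rwa [inf_comm, Subgroup.inf_relIndex_right]
  · rintro _ ⟨-, g, hg, rfl⟩ hgF
    apply haM
    apply M.mem_of_dvd (Finset.dvd_prod_of_mem _
      (Finset.mem_attach _ ⟨g, hF'.mem_toFinset.2 hgF⟩))
    rw [← Ideal.Quotient.eq_zero_iff_mem, map_sub, sub_eq_zero]
    have := congrArg (fun B : SL(n, R ⧸ M) => B (p g hgF).1 (p g hgF).2) (MonoidHom.mem_ker.1 hg)
    simp only [r, Matrix.SpecialLinearGroup.map_apply_coe] at this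
    rw [← map_one (Matrix.SpecialLinearGroup.map (n := Fin n) (Ideal.Quotient.mk M))] at this
    exact this

/-! ### Discrete subgroups -/

/-- A discrete subgroup of `SL_n(ℝ)` has finitely many elements with entries bounded by `C`. -/
theorem finite_setOf_mem_abs_entry_le {n : ℕ} (Γ : Subgroup SL(n, ℝ)) [DiscreteTopology Γ]
    (C : ℝ) : {g : SL(n, ℝ) | g ∈ Γ ∧ ∀ i j, |g i j| ≤ C}.Finite := by
  have hK : IsCompact {A : Matrix (Fin n) (Fin n) ℝ | ∀ i j, A i j ∈ Set.Icc (-C) C} := by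
    have := isCompact_univ_pi (X := fun _ : Fin n => Fin n → ℝ)
      (s := fun _ => Set.pi Set.univ fun _ => Set.Icc (-C) C)
      fun _ => isCompact_univ_pi fun _ => isCompact_Icc
    convert! this using 1
    ext A
    exact ⟨fun h i _ j _ => h i j, fun h i j => h i trivial j trivial⟩
  have hK' := Matrix.SpecialLinearGroup.isClosedEmbedding_val (n := Fin n) (R := ℝ)
    |>.isCompact_preimage hK
  let : UniformSpace SL(n, ℝ) := IsTopologicalGroup.rightUniformSpace _
  have hcl : IsClosed (Γ : Set SL(n, ℝ)) := Subgroup.isClosed_of_discrete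
  have hc := hK'.inter_left hcl
  refine (hc.finite ?_).subset ?_
  · exact (IsDiscrete.mk ‹DiscreteTopology Γ›).mono Set.inter_subset_left
  · rintro g ⟨hg, h⟩
    exact ⟨hg, fun i j => abs_le.1 (h i j)⟩

/-! ### Reduced words -/

section Words

variable {G₁ G₂ : Type*} [Group G₁] [Group G₂]

theorem wordProd_cons (x : G₁ ⊕ G₂) (w : List (G₁ ⊕ G₂)) :
    wordProd (x :: w) = Sum.elim Monoid.Coprod.inl Monoid.Coprod.inr x * wordProd w := by
  simp [wordProd]

theorem exists_isReducedWord_cons (x : G₁ ⊕ G₂) (w : List (G₁ ⊕ G₂)) (hw : IsReducedWord w) :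
    ∃ w', IsReducedWord w' ∧ wordProd w' = wordProd (x :: w) := by
  classical
  by_cases hx : x ≠ Sum.inl 1 ∧ x ≠ Sum.inr 1
  · cases w with
    | nil => exact ⟨[x], ⟨by simpa using hx, by simp⟩, rfl⟩
    | cons y w =>
      have hw' : IsReducedWord w := ⟨fun z hz => hw.1 z (by simp [hz]), hw.2.tail⟩
      by_cases hxy : x.isLeft ≠ y.isLeft
      · exact ⟨x :: y :: w, ⟨by
          intro z hz
          rcases List.mem_cons.1 hz with rfl | hz
          exacts [hx, hw.1 z hz], List.isChain_cons_cons.2 ⟨hxy, hw.2⟩⟩, rfl⟩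
      · -- the two letters lie in the same factor, and are replaced by their product
        have key : ∃ z : G₁ ⊕ G₂, z.isLeft = y.isLeft ∧
            wordProd (z :: w) = wordProd (x :: y :: w) := by
          rcases x with x | x <;> rcases y with y | y <;> simp at hxy
          · exact ⟨Sum.inl (x * y), rfl, by simp [wordProd_cons, mul_assoc]⟩
          · exact ⟨Sum.inr (x * y), rfl, by simp [wordProd_cons, mul_assoc]⟩
        obtain ⟨z, hz, hzw⟩ := key
        by_cases hz1 : z ≠ Sum.inl 1 ∧ z ≠ Sum.inr 1
        · refine ⟨z :: w, ⟨?_, ?_⟩, hzw⟩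
          · intro u hu
            rcases List.mem_cons.1 hu with rfl | hu
            exacts [hz1, hw'.1 u hu]
          · cases w with
            | nil => simp
            | cons u w =>
              have := List.isChain_cons_cons.1 hw.2
              exact List.isChain_cons_cons.2 ⟨by rw [hz]; exact this.1, this.2⟩
        · refine ⟨w, hw', ?_⟩
          rw [← hzw, wordProd_cons]
          by_cases h : z = Sum.inl 1
          · simp [h]
          · have : z = Sum.inr 1 := by tauto
            simp [this]
  · refine ⟨w, hw, ?_⟩
    rw [wordProd_cons]
    by_cases h : x = Sum.inl 1
    · simp [h]
    · have : x = Sum.inr 1 := by tauto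
      simp [this]

theorem exists_isReducedWord (g : Monoid.Coprod G₁ G₂) :
    ∃ w, IsReducedWord w ∧ wordProd w = g := by
  induction g using Monoid.Coprod.induction_on' with
  | one => exact ⟨[], ⟨by simp, by simp⟩, rfl⟩
  | inl_mul x g ih =>
    obtain ⟨w, hw, rfl⟩ := ih
    obtain ⟨w', hw', h⟩ := exists_isReducedWord_cons (Sum.inl x) w hw
    exact ⟨w', hw', by rw [h, wordProd_cons, Sum.elim_inl]⟩
  | inr_mul x g ih =>
    obtain ⟨w, hw, rfl⟩ := ih
    obtain ⟨w', hw', h⟩ := exists_isReducedWord_cons (Sum.inr x) w hw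
    exact ⟨w', hw', by rw [h, wordProd_cons, Sum.elim_inr]⟩

/-- The formal inverse of a word. -/
def invWord (w : List (G₁ ⊕ G₂)) : List (G₁ ⊕ G₂) :=
  (w.map (Sum.map (·⁻¹) (·⁻¹))).reverse

theorem IsReducedWord.invWord {w : List (G₁ ⊕ G₂)} (hw : IsReducedWord w) :
    IsReducedWord (invWord w) := by
  constructor
  · intro x hx
    simp only [_root_.invWord, List.mem_reverse, List.mem_map] at hx
    obtain ⟨y, hy, rfl⟩ := hx
    have := hw.1 y hy
    rcases y with y | y <;> simpa using this
  · rw [_root_.invWord, List.isChain_reverse, List.isChain_map]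
    refine hw.2.imp fun x y h => ?_
    rcases x with x | x <;> rcases y with y | y <;> simp_all

theorem wordProd_invWord (w : List (G₁ ⊕ G₂)) : wordProd (invWord w) = (wordProd w)⁻¹ := by
  induction w with
  | nil => simp [invWord, wordProd]
  | cons x w ih =>
    rw [wordProd_cons, mul_inv_rev, ← ih]
    rcases x with x | x <;> simp [invWord, wordProd]

end Words

/-! ### Singular values -/

section SingularValues

open Module

variable {E : Type*} [NormedAddCommGroup E] [InnerProductSpace ℝ E] [FiniteDimensional ℝ E]

theorem LinearMap.norm_sq_eq_sum_eigenvalues {n : ℕ} (hn : finrank ℝ E = n) (T : E →ₗ[ℝ] E)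
    (u : E) : ‖T u‖ ^ 2 = ∑ i : Fin n, T.singularValues i ^ 2 *
      (T.isSymmetric_adjoint_comp_self.eigenvectorBasis hn).repr u i ^ 2 := by
  set b := T.isSymmetric_adjoint_comp_self.eigenvectorBasis hn
  have h1 : ‖T u‖ ^ 2 = inner ℝ u ((LinearMap.adjoint T ∘ₗ T) u) := by
    rw [LinearMap.comp_apply, LinearMap.adjoint_inner_right, real_inner_self_eq_norm_sq]
  rw [h1, ← b.repr.inner_map_map, PiLp.inner_apply]
  refine Finset.sum_congr rfl fun i _ => ?_
  rw [T.isSymmetric_adjoint_comp_self.eigenvectorBasis_apply_self_apply hn,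
    ← T.sq_singularValues_fin hn]
  simp [b]
  ring

theorem LinearMap.norm_sq_eq_sum_repr {n : ℕ} (hn : finrank ℝ E = n) (T : E →ₗ[ℝ] E)
    (u : E) : ‖u‖ ^ 2 = ∑ i,
      (T.isSymmetric_adjoint_comp_self.eigenvectorBasis hn).repr u i ^ 2 := by
  rw [← (T.isSymmetric_adjoint_comp_self.eigenvectorBasis hn).repr.norm_map u,
    EuclideanSpace.norm_sq_eq]
  simp

theorem LinearMap.norm_apply_le_singularValues_zero (T : E →ₗ[ℝ] E) (u : E) :
    ‖T u‖ ≤ T.singularValues 0 * ‖u‖ := by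
  refine le_of_sq_le_sq ?_ (mul_nonneg (T.singularValues_nonneg 0) (norm_nonneg u))
  rw [T.norm_sq_eq_sum_eigenvalues rfl, mul_pow, T.norm_sq_eq_sum_repr rfl u, Finset.mul_sum]
  refine Finset.sum_le_sum fun i _ => ?_
  gcongr
  · exact T.singularValues_nonneg _
  · exact T.singularValues_antitone (Nat.zero_le _)

theorem LinearMap.singularValues_last_mul_norm_le (T : E →ₗ[ℝ] E) (u : E) :
    T.singularValues (finrank ℝ E - 1) * ‖u‖ ≤ ‖T u‖ := by
  refine le_of_sq_le_sq ?_ (norm_nonneg _)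
  rw [T.norm_sq_eq_sum_eigenvalues rfl, mul_pow, T.norm_sq_eq_sum_repr rfl u, Finset.mul_sum]
  refine Finset.sum_le_sum fun i _ => ?_
  gcongr
  · exact T.singularValues_nonneg _
  · exact T.singularValues_antitone (by have := i.2; omega)

theorem LinearMap.exists_norm_apply_eq_singularValues (T : E →ₗ[ℝ] E) {i : ℕ}
    (hi : i < finrank ℝ E) : ∃ u, ‖u‖ = 1 ∧ ‖T u‖ = T.singularValues i := by
  classical
  refine ⟨T.isSymmetric_adjoint_comp_self.eigenvectorBasis rfl ⟨i, hi⟩,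
    OrthonormalBasis.norm_eq_one _ _, ?_⟩
  have := T.norm_sq_eq_sum_eigenvalues rfl
    (T.isSymmetric_adjoint_comp_self.eigenvectorBasis rfl ⟨i, hi⟩)
  simp only [OrthonormalBasis.repr_self, PiLp.single_apply] at this
  simp [ite_pow] at this
  exact (sq_eq_sq₀ (norm_nonneg _) (T.singularValues_nonneg i)).1 this

theorem singularRatio_nonneg {n : ℕ} (A : Matrix (Fin n) (Fin n) ℝ) : 0 ≤ singularRatio A :=
  div_nonneg (LinearMap.singularValues_nonneg _ _) (LinearMap.singularValues_nonneg _ _)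

section Frobenius

attribute [local instance] Matrix.frobeniusNormedAddCommGroup Matrix.frobeniusNormedSpace
  Matrix.frobeniusNormedRing

theorem Matrix.norm_toEuclideanLin_le_frobenius {n : ℕ} (A : Matrix (Fin n) (Fin n) ℝ)
    (u : EuclideanSpace ℝ (Fin n)) : ‖A.toEuclideanLin u‖ ≤ ‖A‖ * ‖u‖ := by
  have h := Matrix.frobenius_norm_mul A (Matrix.replicateCol Unit u.ofLp)
  rw [← Matrix.replicateCol_mulVec, Matrix.frobenius_norm_replicateCol,
    Matrix.frobenius_norm_replicateCol] at h
  exact h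

/-- The ratio of extreme singular values is at most the condition number for the Frobenius norm. -/
theorem singularRatio_le_frobenius {n : ℕ} (hn : 0 < n) {A B : Matrix (Fin n) (Fin n) ℝ}
    (hBA : B * A = 1) : singularRatio A ≤ ‖A‖ * ‖B‖ := by
  have hdim : finrank ℝ (EuclideanSpace ℝ (Fin n)) = n := by simp
  obtain ⟨u, hu, hu'⟩ := A.toEuclideanLin.exists_norm_apply_eq_singularValues (i := 0)
    (by rw [hdim]; exact hn)
  obtain ⟨v, hv, hv'⟩ := A.toEuclideanLin.exists_norm_apply_eq_singularValues (i := n - 1)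
    (by rw [hdim]; omega)
  have h1 := A.norm_toEuclideanLin_le_frobenius u
  have h2 := B.norm_toEuclideanLin_le_frobenius (A.toEuclideanLin v)
  have h3 : B.toEuclideanLin (A.toEuclideanLin v) = v := by
    simp [Matrix.toLpLin_apply, Matrix.mulVec_mulVec, hBA]
  rw [hu, hu', mul_one] at h1
  rw [h3, hv, hv'] at h2
  have hpos : 0 < A.toEuclideanLin.singularValues (n - 1) := by
    refine lt_of_le_of_ne (LinearMap.singularValues_nonneg _ _) fun h => ?_
    rw [← h] at h2
    norm_num at h2
  rw [singularRatio, div_le_iff₀ hpos]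
  nlinarith [norm_nonneg A]

end Frobenius

/-- Growth of a matrix on one vector and of its inverse on another one bounds the ratio of extreme
singular values from below. -/
theorem le_singularRatio {n : ℕ} {A B : Matrix (Fin n) (Fin n) ℝ} (hAB : A * B = 1)
    {u v : EuclideanSpace ℝ (Fin n)} (hu : u ≠ 0) (hv : v ≠ 0) {a b : ℝ} (ha : 0 ≤ a)
    (hA : a * ‖u‖ ≤ ‖A.toEuclideanLin u‖) (hB : b * ‖v‖ ≤ ‖B.toEuclideanLin v‖) :
    a * b ≤ singularRatio A := by
  have hn : 0 < n := by
    rcases Nat.eq_zero_or_pos n with rfl | h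
    · exact absurd (Subsingleton.elim u 0) hu
    · exact h
  have hdim : finrank ℝ (EuclideanSpace ℝ (Fin n)) = n := by simp
  have h1 := A.toEuclideanLin.norm_apply_le_singularValues_zero u
  have h2 := A.toEuclideanLin.singularValues_last_mul_norm_le (B.toEuclideanLin v)
  have h3 : A.toEuclideanLin (B.toEuclideanLin v) = v := by
    simp [Matrix.toLpLin_apply, Matrix.mulVec_mulVec, hAB]
  rw [hdim, h3] at h2
  have hu' := norm_pos_iff.2 hu
  have hv' := norm_pos_iff.2 hv
  have hpos : 0 < A.toEuclideanLin.singularValues (n - 1) := by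
    obtain ⟨x, hx, hx'⟩ := A.toEuclideanLin.exists_norm_apply_eq_singularValues (i := n - 1)
      (by rw [hdim]; omega)
    rw [← hx', norm_pos_iff]
    intro h0
    have h4 : B.toEuclideanLin (A.toEuclideanLin x) = x := by
      simp [Matrix.toLpLin_apply, Matrix.mulVec_mulVec, mul_eq_one_comm.1 hAB]
    rw [h0, map_zero] at h4
    rw [← h4, norm_zero] at hx
    norm_num at hx
  have h5 : a ≤ A.toEuclideanLin.singularValues 0 := le_of_mul_le_mul_right (hA.trans h1) hu'
  have h6 : A.toEuclideanLin.singularValues (n - 1) * b ≤ 1 := by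
    refine le_of_mul_le_mul_right ?_ hv'
    calc _ = A.toEuclideanLin.singularValues (n - 1) * (b * ‖v‖) := by ring
      _ ≤ A.toEuclideanLin.singularValues (n - 1) * ‖B.toEuclideanLin v‖ := by gcongr
      _ ≤ 1 * ‖v‖ := by rw [one_mul]; exact h2
  rw [singularRatio, le_div_iff₀ hpos]
  nlinarith [LinearMap.singularValues_nonneg A.toEuclideanLin (n - 1)]

end SingularValues

/-! ### The representation -/

/-- The representation of `SL_d(ℝ)` on `M_d(ℝ) × ℝ × ℝ^r` by `S ↦ g S gᵀ` on the first factor, and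
trivial on the other two. -/
def congrRep (d r : ℕ) :
    SL(d, ℝ) →* Module.End ℝ (Matrix (Fin d) (Fin d) ℝ × ℝ × (Fin r → ℝ)) where
  toFun g :=
    { toFun := fun v => (g.1 * v.1 * g.1.transpose, v.2)
      map_add' := fun u v => by simp [mul_add, add_mul]
      map_smul' := fun c v => by simp }
  map_one' := by ext v <;> simp
  map_mul' g h := by
    refine LinearMap.ext fun v => ?_
    simp [Matrix.mul_assoc]

/-- The dilation factor of the involution `coneSwap`. -/
def dilation (d : ℕ) : ℝ := 8 * d ^ 2 * (d + 2)

/-- The linear involution that exchanges `(I, 0, 0)` with `λ (I, 1, 0)`, and fixes the traceless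
matrices and the last factor. For large `λ` it sends a cone around `M_d(ℝ)` on which the trace is
positive to a narrow cone around `(I, 1, 0)`. -/
noncomputable def coneSwap (d r : ℕ) :
    Module.End ℝ (Matrix (Fin d) (Fin d) ℝ × ℝ × (Fin r → ℝ)) where
  toFun v :=
    (v.1 + (v.2.1 * (dilation d)⁻¹ + (v.1.trace / d - v.2.1) * dilation d - v.1.trace / d) • 1,
      (v.1.trace / d - v.2.1) * dilation d, v.2.2)
  map_add' u v := by
    ext <;> simp [Matrix.trace_add, add_div] <;> ring
  map_smul' c v := by
    ext <;> simp [Matrix.trace_smul] <;> ring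

theorem dilation_pos {d : ℕ} (hd : 0 < d) : 0 < dilation d := by
  unfold dilation; positivity

theorem coneSwap_mul_self {d : ℕ} (hd : 0 < d) (r : ℕ) : coneSwap d r * coneSwap d r = 1 := by
  refine LinearMap.ext fun v => ?_
  have h := (dilation_pos hd).ne'
  have hd' : (d : ℝ) ≠ 0 := by positivity
  have htr (c : ℝ) : (v.1 + c • (1 : Matrix (Fin d) (Fin d) ℝ)).trace / d
      = v.1.trace / d + c := by
    rw [Matrix.trace_add, Matrix.trace_smul, Matrix.trace_one, Fintype.card_fin, smul_eq_mul]
    field_simp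
  rw [Module.End.mul_apply, Module.End.one_apply]
  refine Prod.ext ?_ (Prod.ext ?_ rfl)
  · simp only [coneSwap, LinearMap.coe_mk, AddHom.coe_mk, htr]
    rw [add_assoc, ← add_smul]
    convert add_zero v.1
    rw [smul_eq_zero]
    left
    field_simp
    ring
  · simp only [coneSwap, LinearMap.coe_mk, AddHom.coe_mk, htr]
    field_simp
    ring

/-- The representation of `SL_d(ℝ) ∗ SL_d(ℝ)` given by `congrRep` on the first factor and by its
conjugate under `coneSwap` on the second one. -/
noncomputable def pingPongRep {d : ℕ} (hd : 0 < d) (r : ℕ) :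
    Monoid.Coprod SL(d, ℝ) SL(d, ℝ) →*
      Module.End ℝ (Matrix (Fin d) (Fin d) ℝ × ℝ × (Fin r → ℝ)) :=
  Monoid.Coprod.lift (congrRep d r)
    { toFun := fun g => coneSwap d r * congrRep d r g * coneSwap d r
      map_one' := by rw [map_one, mul_one, coneSwap_mul_self hd]
      map_mul' := fun g h => by
        rw [map_mul]
        calc _ = coneSwap d r * congrRep d r g * 1 * congrRep d r h * coneSwap d r := by
              simp only [mul_one, mul_assoc]
          _ = _ := by rw [← coneSwap_mul_self hd r]; simp only [mul_assoc] }

/-! ### The ping-pong cones -/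

section Cones

attribute [local instance] Matrix.frobeniusNormedAddCommGroup Matrix.frobeniusNormedSpace
  Matrix.frobeniusNormedRing Matrix.frobeniusNormedAlgebra

variable {d r : ℕ}

theorem Matrix.frobenius_norm_sq (A : Matrix (Fin d) (Fin d) ℝ) :
    ‖A‖ ^ 2 = ∑ i, ∑ j, A i j ^ 2 := by
  rw [Matrix.frobenius_norm_def, ← Real.sqrt_eq_rpow, Real.sq_sqrt (by positivity)]
  simp

theorem Matrix.abs_entry_le_frobenius_norm (A : Matrix (Fin d) (Fin d) ℝ) (i j : Fin d) :
    |A i j| ≤ ‖A‖ := by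
  refine abs_le_of_sq_le_sq ?_ (norm_nonneg _)
  rw [A.frobenius_norm_sq]
  calc A i j ^ 2 ≤ ∑ j, A i j ^ 2 :=
        Finset.single_le_sum (f := fun j => A i j ^ 2) (fun _ _ => sq_nonneg _) (Finset.mem_univ j)
    _ ≤ _ := Finset.single_le_sum (f := fun i => ∑ j, A i j ^ 2)
        (fun _ _ => Finset.sum_nonneg fun _ _ => sq_nonneg _) (Finset.mem_univ i)

theorem Matrix.abs_trace_le_frobenius_norm (A : Matrix (Fin d) (Fin d) ℝ) :
    |A.trace| ≤ d * ‖A‖ := by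
  calc |A.trace| ≤ ∑ i, |A i i| := Finset.abs_sum_le_sum_abs _ _
    _ ≤ ∑ _i : Fin d, ‖A‖ := Finset.sum_le_sum fun i _ => A.abs_entry_le_frobenius_norm i i
    _ = d * ‖A‖ := by simp

theorem Matrix.trace_mul_transpose_self_eq_frobenius (A : Matrix (Fin d) (Fin d) ℝ) :
    (A * A.transpose).trace = ‖A‖ ^ 2 := by
  rw [A.frobenius_norm_sq]
  simp [Matrix.trace, Matrix.mul_apply, sq]

theorem Matrix.frobenius_norm_one_le : ‖(1 : Matrix (Fin d) (Fin d) ℝ)‖ ≤ d := by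
  refine le_of_sq_le_sq ?_ (Nat.cast_nonneg d)
  rw [← Matrix.trace_mul_transpose_self_eq_frobenius]
  simp only [Matrix.transpose_one, mul_one, Matrix.trace_one, Fintype.card_fin]
  exact_mod_cast Nat.le_self_pow two_ne_zero d

theorem Matrix.frobenius_norm_congr_le (A S : Matrix (Fin d) (Fin d) ℝ) :
    ‖A * S * A.transpose‖ ≤ ‖A‖ ^ 2 * ‖S‖ := by
  calc ‖A * S * A.transpose‖ ≤ ‖A‖ * ‖S‖ * ‖A.transpose‖ :=
        (norm_mul_le _ _).trans (by gcongr; exact norm_mul_le _ _)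
    _ = _ := by rw [Matrix.frobenius_norm_transpose]; ring

/-- The two ping-pong cones in `M_d(ℝ) × ℝ × ℝ^r`, cut off at height `c`. For `true`, the cone lies
around `M_d(ℝ)`, the trace is positive on it, and the height is the trace. For `false`, it lies
around `(I, 1, 0)`, and the height is the second coordinate. The last coordinate is irrelevant. -/
def InCone (d r : ℕ) : Bool → ℝ → Matrix (Fin d) (Fin d) ℝ × ℝ × (Fin r → ℝ) → Prop
  | true, c, v => c ≤ v.1.trace ∧ 0 < v.1.trace ∧ ‖v.1‖ ≤ 2 * (d + 1) * v.1.trace ∧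
      |v.2.1| ≤ v.1.trace / (2 * d)
  | false, c, v => c ≤ v.2.1 ∧ 0 < v.2.1 ∧ ‖v.1 - v.2.1 • 1‖ ≤ v.2.1 / (2 * d)

/-- A large `g` maps the cone around `(I, 1, 0)` into the one around `M_d(ℝ)`, because the trace of
`g gᵀ` is the square of the Frobenius norm of `g`. -/
theorem InCone.congrRep (hd : 0 < d) {g : SL(d, ℝ)} (hg : 4 * d ≤ ‖g.1‖ ^ 2) {c : ℝ}
    {v : Matrix (Fin d) (Fin d) ℝ × ℝ × (Fin r → ℝ)} (hv : InCone d r false c v) :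
    InCone d r true (‖g.1‖ ^ 2 / 2 * c) (congrRep d r g v) := by
  obtain ⟨S, t, x⟩ := v
  obtain ⟨hc, ht, hS⟩ := hv
  simp only at hc ht hS
  have hd0 : (0 : ℝ) < d := by positivity
  have hd1 : (1 : ℝ) ≤ d := by exact_mod_cast hd
  set q := ‖g.1‖ ^ 2 with hq
  have hq0 : 0 < q := by linarith
  have hcongr : g.1 * S * g.1.transpose =
      t • (g.1 * g.1.transpose) + g.1 * (S - t • 1) * g.1.transpose := by
    simp [mul_sub, sub_mul]
  have htr : t * q / 2 ≤ (g.1 * S * g.1.transpose).trace := by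
    rw [hcongr, Matrix.trace_add, Matrix.trace_smul, Matrix.trace_mul_transpose_self_eq_frobenius,
      smul_eq_mul, ← hq]
    have h1 := (abs_le.1 (Matrix.abs_trace_le_frobenius_norm
      (g.1 * (S - t • 1) * g.1.transpose))).1
    have h2 := Matrix.frobenius_norm_congr_le g.1 (S - t • 1)
    have h3 : d * (q * (t / (2 * d))) = t * q / 2 := by field_simp
    have h4 : d * ‖g.1 * (S - t • 1) * g.1.transpose‖ ≤ d * (q * (t / (2 * d))) := by
      gcongr
      exact h2.trans (by gcongr)
    linarith
  have hSn : ‖S‖ ≤ (d + 1) * t := by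
    have h1 : ‖S‖ ≤ ‖S - t • (1 : Matrix (Fin d) (Fin d) ℝ)‖ +
        ‖t • (1 : Matrix (Fin d) (Fin d) ℝ)‖ := by
      simpa using norm_add_le (S - t • (1 : Matrix (Fin d) (Fin d) ℝ)) (t • 1)
    rw [norm_smul, Real.norm_of_nonneg ht.le] at h1
    have h2 : t / (2 * d) ≤ t := div_le_self ht.le (by linarith)
    have h3 := mul_le_mul_of_nonneg_left (Matrix.frobenius_norm_one_le (d := d)) ht.le
    linarith
  have hpos : 0 < t * q / 2 := by positivity
  refine ⟨?_, hpos.trans_le htr, ?_, ?_⟩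
  · refine le_trans ?_ htr
    nlinarith
  · calc ‖g.1 * S * g.1.transpose‖ ≤ q * ‖S‖ := Matrix.frobenius_norm_congr_le _ _
      _ ≤ q * ((d + 1) * t) := by gcongr
      _ = 2 * (d + 1) * (t * q / 2) := by ring
      _ ≤ _ := by gcongr; exact htr
  · change |t| ≤ (g.1 * S * g.1.transpose).trace / (2 * d)
    rw [abs_of_pos ht, le_div_iff₀ (by positivity)]
    refine le_trans ?_ htr
    nlinarith

theorem InCone.coneSwap (hd : 0 < d) {c : ℝ}
    {v : Matrix (Fin d) (Fin d) ℝ × ℝ × (Fin r → ℝ)} (hv : InCone d r true c v) :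
    InCone d r false c (coneSwap d r v) := by
  obtain ⟨S, t, x⟩ := v
  obtain ⟨hc, hT, hS, ht⟩ := hv
  simp only at hc hT hS ht
  have hd0 : (0 : ℝ) < d := by positivity
  have hd1 : (1 : ℝ) ≤ d := by exact_mod_cast hd
  have hl := dilation_pos hd
  set s := S.trace / d with hs
  have hTs : S.trace = d * s := by rw [hs]; field_simp
  have hs0 : 0 < s := by positivity
  have hts : |t| ≤ s / 2 := by
    refine ht.trans (le_of_eq ?_)
    rw [hTs]; field_simp
  have hst : s / 2 ≤ s - t := by linarith [(abs_le.1 hts).2]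
  have hl1 : 8 * (d : ℝ) ^ 2 * (d + 2) = dilation d := rfl
  have hld : 2 * (d : ℝ) ≤ dilation d := by
    rw [← hl1]
    nlinarith [mul_nonneg hd0.le hd0.le, mul_nonneg (mul_nonneg hd0.le hd0.le) hd0.le]
  have hheight : s / 2 * dilation d ≤ (s - t) * dilation d := by gcongr
  refine ⟨?_, ?_, ?_⟩
  · change c ≤ (s - t) * dilation d
    refine hc.trans ?_
    rw [hTs]
    nlinarith
  · change 0 < (s - t) * dilation d
    nlinarith
  · change ‖S + (t * (dilation d)⁻¹ + (s - t) * dilation d - s) •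
      (1 : Matrix (Fin d) (Fin d) ℝ) - ((s - t) * dilation d) • 1‖
      ≤ (s - t) * dilation d / (2 * d)
    have h1 : S + (t * (dilation d)⁻¹ + (s - t) * dilation d - s) •
        (1 : Matrix (Fin d) (Fin d) ℝ) - ((s - t) * dilation d) • 1
        = S + (t * (dilation d)⁻¹ - s) • 1 := by
      rw [add_sub_assoc, ← sub_smul]; congr 2; ring
    have h2 : |t * (dilation d)⁻¹ - s| ≤ 2 * s := by
      have h3 : |t * (dilation d)⁻¹| ≤ |t| := by
        rw [abs_mul, abs_of_pos (inv_pos.2 hl)]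
        exact mul_le_of_le_one_right (abs_nonneg _) (inv_le_one_of_one_le₀ (by linarith))
      have h4 := abs_sub (t * (dilation d)⁻¹) s
      rw [abs_of_pos hs0] at h4
      linarith
    rw [h1]
    calc ‖S + (t * (dilation d)⁻¹ - s) • (1 : Matrix (Fin d) (Fin d) ℝ)‖
        ≤ ‖S‖ + |t * (dilation d)⁻¹ - s| * ‖(1 : Matrix (Fin d) (Fin d) ℝ)‖ := by
          refine (norm_add_le _ _).trans ?_
          rw [norm_smul, Real.norm_eq_abs]
      _ ≤ 2 * (d + 1) * (d * s) + 2 * s * d := by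
          rw [← hTs]
          gcongr
          exact Matrix.frobenius_norm_one_le
      _ = s / 2 * dilation d / (2 * d) := by rw [← hl1]; field_simp; ring
      _ ≤ _ := by gcongr

theorem inCone_initial (hd : 0 < d) (l : Bool) :
    InCone d r l 1 ((1 : Matrix (Fin d) (Fin d) ℝ), if l then 0 else 1, 0) := by
  have hd0 : (0 : ℝ) < d := by positivity
  have hd1 : (1 : ℝ) ≤ d := by exact_mod_cast hd
  cases l
  · refine ⟨by simp, by simp, ?_⟩
    simp
  · refine ⟨?_, ?_, ?_, ?_⟩
    · simpa using Nat.one_le_iff_ne_zero.2 hd.ne'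
    · simpa using hd
    · have := Matrix.frobenius_norm_one_le (d := d)
      simp only [Matrix.trace_one, Fintype.card_fin]
      nlinarith
    · simp only [if_true, abs_zero, Matrix.trace_one, Fintype.card_fin]
      positivity

/-- A reduced word with large letters maps one of the vectors `(I, 0, 0)`, `(I, 1, 0)` to a vector
in the cone that belongs to its first letter, and the height is at least multiplicative. -/
theorem exists_inCone_pingPongRep (hd : 0 < d) {H₁ H₂ : Subgroup SL(d, ℝ)} (x : H₁ ⊕ H₂)
    (w : List (H₁ ⊕ H₂)) (hw : (x :: w).IsChain fun x y => x.isLeft ≠ y.isLeft)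
    (hlarge : ∀ y ∈ x :: w, 4 * d ≤ ‖letterMatrix y‖ ^ 2) :
    ∃ l : Bool, InCone d r x.isLeft ((x :: w).map fun y => ‖letterMatrix y‖ ^ 2 / 2).prod
      (pingPongRep hd r (Monoid.Coprod.map H₁.subtype H₂.subtype (wordProd (x :: w)))
        (1, if l then 0 else 1, 0)) := by
  have step (x : H₁ ⊕ H₂) (hx : 4 * d ≤ ‖letterMatrix x‖ ^ 2) (c : ℝ)
      (v : Matrix (Fin d) (Fin d) ℝ × ℝ × (Fin r → ℝ)) (hv : InCone d r (!x.isLeft) c v) :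
      InCone d r x.isLeft (‖letterMatrix x‖ ^ 2 / 2 * c) (pingPongRep hd r
        (Monoid.Coprod.map H₁.subtype H₂.subtype
          (Sum.elim Monoid.Coprod.inl Monoid.Coprod.inr x)) v) := by
    rcases x with x | x
    · exact InCone.congrRep hd (g := x.1) hx hv
    · exact ((hv.coneSwap hd).congrRep hd (g := x.1) hx).coneSwap hd
  induction w generalizing x with
  | nil =>
    refine ⟨!x.isLeft, ?_⟩
    rw [wordProd_cons, List.map_cons, List.prod_cons]
    simpa [wordProd] using step x (hlarge x (by simp)) _ _ (inCone_initial hd _)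
  | cons y w ih =>
    rw [List.isChain_cons_cons] at hw
    obtain ⟨l, hl⟩ := ih y hw.2 fun z hz => hlarge z (List.mem_cons_of_mem _ hz)
    refine ⟨l, ?_⟩
    rw [wordProd_cons, List.map_cons, List.prod_cons, map_mul, map_mul]
    refine step x (hlarge x (by simp)) _ _ ?_
    have : y.isLeft = !x.isLeft := by
      have := hw.1
      revert this
      cases x.isLeft <;> cases y.isLeft <;> simp
    rwa [← this]

end Cones

/-! ### Passage to `GL_m(ℝ)` -/

section MatrixForm

variable {V : Type*} [AddCommGroup V] [Module ℝ V] {G : Type*} [Group G] {m : ℕ}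

/-- The matrix form of a real representation with respect to a basis. -/
noncomputable def matrixRep (b : Module.Basis (Fin m) ℝ V) (P : G →* Module.End ℝ V) :
    G →* GL (Fin m) ℝ :=
  ((LinearMap.toMatrixAlgEquiv b : Module.End ℝ V →* Matrix (Fin m) (Fin m) ℝ).comp P).toHomUnits

theorem matrixRep_mulVec (b : Module.Basis (Fin m) ℝ V) (P : G →* Module.End ℝ V) (g : G) (v : V) :
    (matrixRep b P g).val.toEuclideanLin (WithLp.toLp 2 (b.equivFun v)) =
      WithLp.toLp 2 (b.equivFun (P g v)) := by
  have h : (matrixRep b P g).val.mulVec (b.equivFun v) = b.equivFun (P g v) :=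
    LinearMap.toMatrix_mulVec_repr b b (P g) v
  rw [Matrix.toLpLin_toLp, Matrix.toLin'_apply, h]

theorem exists_abs_le_mul_norm_repr (b : Module.Basis (Fin m) ℝ V) (φ : V →ₗ[ℝ] ℝ) :
    ∃ C, ∀ v, |φ v| ≤ C * ‖(WithLp.toLp 2 (b.equivFun v) : EuclideanSpace ℝ (Fin m))‖ := by
  let e : EuclideanSpace ℝ (Fin m) →ₗ[ℝ] V :=
    b.equivFun.symm.toLinearMap ∘ₗ (WithLp.linearEquiv 2 ℝ (Fin m → ℝ)).toLinearMap
  let f := LinearMap.toContinuousLinearMap (φ ∘ₗ e)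
  refine ⟨‖f‖, fun v => ?_⟩
  have h : f (WithLp.toLp 2 (b.equivFun v)) = φ v := by
    change φ (b.equivFun.symm (b.equivFun v)) = φ v
    rw [LinearEquiv.symm_apply_apply]
  rw [← h]
  exact f.le_opNorm _

/-- A homomorphism is discrete and faithful if finitely many vectors witness, for every nontrivial
element, that its image is far from the identity. -/
theorem isDiscreteFaithful_of_expanding (ρ : G →* GL (Fin m) ℝ)
    {ι : Type*} [Finite ι] (u : ι → EuclideanSpace ℝ (Fin m)) (hu : ∀ l, u l ≠ 0)
    (h : ∀ g, g ≠ 1 → ∃ l, 2 * ‖u l‖ ≤ ‖(ρ g).val.toEuclideanLin (u l)‖) :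
    IsDiscreteFaithful ρ := by
  let U : Set (GL (Fin m) ℝ) := {A | ∀ l, ‖A.val.toEuclideanLin (u l)‖ < 2 * ‖u l‖}
  have hU : IsOpen U := by
    have : U = ⋂ l, {A : GL (Fin m) ℝ | ‖A.val.toEuclideanLin (u l)‖ < 2 * ‖u l‖} := by
      ext; simp [U]
    rw [this]
    refine isOpen_iInter_of_finite fun l => isOpen_lt ?_ continuous_const
    refine Continuous.norm ?_
    change Continuous fun A : GL (Fin m) ℝ => WithLp.toLp 2 (A.val.mulVec (u l).ofLp)
    exact (PiLp.continuous_toLp 2 _).comp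
      (Continuous.matrix_mulVec Units.continuous_val continuous_const)
  have h1U : (1 : GL (Fin m) ℝ) ∈ U := by
    intro l
    have := norm_pos_iff.2 (hu l)
    have h1 : (1 : GL (Fin m) ℝ).val.toEuclideanLin (u l) = u l := by
      simp
    rw [h1]
    linarith
  have hmem (g : G) (hg : ρ g ∈ U) : g = 1 := by
    by_contra hne
    obtain ⟨l, hl⟩ := h g hne
    exact absurd (hg l) (not_lt.2 hl)
  refine ⟨(injective_iff_map_eq_one ρ).2 fun g hg => hmem g (by rw [hg]; exact h1U), ?_⟩
  refine discreteTopology_of_isOpen_singleton_one ?_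
  have : ({1} : Set ρ.range) = Subtype.val ⁻¹' U := by
    ext ⟨_, g, rfl⟩
    simp only [Set.mem_singleton_iff, Set.mem_preimage]
    constructor
    · intro hg
      have h2 : ρ g = 1 := congrArg Subtype.val hg
      rw [h2]
      exact h1U
    · intro hg
      have := hmem g hg
      subst this
      exact Subtype.ext (map_one ρ)
  rw [this]
  exact hU.preimage continuous_subtype_val

end MatrixForm

/-! ### Growth of reduced words -/

section Growth

attribute [local instance] Matrix.frobeniusNormedAddCommGroup

/-- Up to a constant, every reduced word with large letters stretches one of two fixed vectors by
the product of the heights of its letters. -/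
theorem exists_pingPongRep_growth {d r m : ℕ} (hd : 0 < d)
    (b : Module.Basis (Fin m) ℝ (Matrix (Fin d) (Fin d) ℝ × ℝ × (Fin r → ℝ))) :
    ∃ u : Bool → EuclideanSpace ℝ (Fin m), (∀ l, u l ≠ 0) ∧ ∃ K : ℝ, 1 ≤ K ∧
      ∀ (H₁ H₂ : Subgroup SL(d, ℝ)) (w : List (H₁ ⊕ H₂)), w ≠ [] → IsReducedWord w →
        (∀ y ∈ w, 4 * d ≤ ‖letterMatrix y‖ ^ 2) →
        ∃ l, (w.map fun y => ‖letterMatrix y‖ ^ 2 / 2).prod / K * ‖u l‖ ≤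
          ‖(restrictCoprod (matrixRep b (pingPongRep hd r)) H₁ H₂
            (wordProd w)).val.toEuclideanLin (u l)‖ := by
  let u : Bool → EuclideanSpace ℝ (Fin m) := fun l =>
    WithLp.toLp 2 (b.equivFun ((1 : Matrix (Fin d) (Fin d) ℝ), if l then 0 else 1, 0))
  obtain ⟨C₁, hC₁⟩ := exists_abs_le_mul_norm_repr b
    (Matrix.traceLinearMap (Fin d) ℝ ℝ ∘ₗ LinearMap.fst ℝ _ _)
  obtain ⟨C₂, hC₂⟩ := exists_abs_le_mul_norm_repr b
    (LinearMap.fst ℝ _ _ ∘ₗ LinearMap.snd ℝ (Matrix (Fin d) (Fin d) ℝ) (ℝ × (Fin r → ℝ)))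
  set C := max 1 (max C₁ C₂) with hC
  set D := max 1 (max ‖u true‖ ‖u false‖) with hD
  have hC1 : 1 ≤ C := le_max_left _ _
  have hD1 : 1 ≤ D := le_max_left _ _
  have huD (l : Bool) : ‖u l‖ ≤ D := by cases l <;> simp [hD]
  refine ⟨u, fun l h => ?_, C * D, one_le_mul_of_one_le_of_one_le hC1 hD1, ?_⟩
  · have h1 : b.equivFun ((1 : Matrix (Fin d) (Fin d) ℝ), if l then 0 else 1, 0) = 0 :=
      congrArg WithLp.ofLp h
    have h2 : ((1 : Matrix (Fin d) (Fin d) ℝ), (if l then 0 else 1 : ℝ), (0 : Fin r → ℝ)) = 0 :=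
      b.equivFun.map_eq_zero_iff.1 h1
    have h3 := congrArg (fun v => v.1 ⟨0, hd⟩ ⟨0, hd⟩) h2
    simp at h3
  · intro H₁ H₂ w hne hw hlarge
    obtain ⟨x, w, rfl⟩ := List.exists_cons_of_ne_nil hne
    obtain ⟨l, hl⟩ := exists_inCone_pingPongRep (r := r) hd x w hw.2 hlarge
    refine ⟨l, ?_⟩
    rw [restrictCoprod, MonoidHom.comp_apply, matrixRep_mulVec]
    set v := pingPongRep hd r (Monoid.Coprod.map H₁.subtype H₂.subtype (wordProd (x :: w)))
        (1, if l then 0 else 1, 0)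
    set p := ((x :: w).map fun y => ‖letterMatrix y‖ ^ 2 / 2).prod
    have hp : p ≤ C * ‖(WithLp.toLp 2 (b.equivFun v) : EuclideanSpace ℝ (Fin m))‖ := by
      cases hx : x.isLeft <;> rw [hx] at hl
      · refine (hl.1.trans (le_abs_self _)).trans ((hC₂ v).trans ?_)
        gcongr
        exact (le_max_right _ _).trans (le_max_right _ _)
      · refine (hl.1.trans (le_abs_self _)).trans ((hC₁ v).trans ?_)
        gcongr
        exact (le_max_left _ _).trans (le_max_right _ _)
    rw [div_mul_eq_mul_div, div_le_iff₀ (by positivity)]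
    calc p * ‖u l‖ ≤ (C * ‖(WithLp.toLp 2 (b.equivFun v) : EuclideanSpace ℝ (Fin m))‖) * D := by
          gcongr
          exact huD l
      _ = _ := by ring

/-- A finitely generated discrete subgroup has a finite-index subgroup whose nontrivial elements
are all large. -/
theorem exists_isFiniteRelIndex_frobenius_large {d : ℕ} (Γ : Subgroup SL(d, ℝ)) (hΓ : Γ.FG)
    [DiscreteTopology Γ] (Q : ℝ) :
    ∃ H ≤ Γ, H.IsFiniteRelIndex Γ ∧ ∀ g ∈ H, g ≠ 1 → Q ≤ ‖g.1‖ ^ 2 := by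
  obtain ⟨H, hH, hfin, h⟩ := exists_isFiniteRelIndex_disjoint Γ hΓ
    (F := {g | g ∈ Γ ∧ ∀ i j, |g i j| ≤ max 1 Q} \ {1})
    ((finite_setOf_mem_abs_entry_le Γ (max 1 Q)).subset Set.sdiff_subset) (by simp)
  refine ⟨H, hH, hfin, fun g hg hne => ?_⟩
  by_contra! hlt
  refine h g hg ⟨⟨hH hg, fun i j => (Matrix.abs_entry_le_frobenius_norm g.1 i j).trans ?_⟩, hne⟩
  by_contra! hlt'
  nlinarith [le_max_left 1 Q, le_max_right 1 Q]

theorem prod_rpow_le_prod_half {α : Type*} {q : α → ℝ} {s M : ℝ} (hM : 1 ≤ M) {w : List α}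
    (hne : w ≠ []) (hq : ∀ y ∈ w, 0 ≤ q y ∧ M * q y ^ s ≤ q y / 2) :
    M * (w.map fun y => q y ^ s).prod ≤ (w.map fun y => q y / 2).prod := by
  have hle : ∀ w : List α, (∀ y ∈ w, 0 ≤ q y ∧ M * q y ^ s ≤ q y / 2) →
      0 ≤ (w.map fun y => q y ^ s).prod ∧
        (w.map fun y => q y ^ s).prod ≤ (w.map fun y => q y / 2).prod := by
    intro w
    induction w with
    | nil => simp
    | cons y w ih =>
      intro h
      obtain ⟨h1, h2⟩ := h y (by simp)
      obtain ⟨h3, h4⟩ := ih fun z hz => h z (by simp [hz])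
      have h5 := Real.rpow_nonneg h1 s
      simp only [List.map_cons, List.prod_cons]
      refine ⟨mul_nonneg h5 h3, mul_le_mul ?_ h4 h3 (by linarith)⟩
      nlinarith
  obtain ⟨y, w, rfl⟩ := List.exists_cons_of_ne_nil hne
  obtain ⟨h1, h2⟩ := hq y (by simp)
  obtain ⟨h3, h4⟩ := hle w fun z hz => hq z (by simp [hz])
  simp only [List.map_cons, List.prod_cons]
  rw [← mul_assoc]
  exact mul_le_mul h2 h4 h3 (by linarith)

/-- The threshold beyond which half of `q` exceeds a given multiple of a smaller power of `q`. -/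
theorem mul_rpow_le_half {ε M q : ℝ} (hε : 0 < ε) (hM : 1 ≤ M) (hq : (2 * M) ^ (2 / ε) ≤ q) :
    M * q ^ (1 - ε / 2) ≤ q / 2 := by
  have h0 : 0 < q := (Real.rpow_pos_of_pos (by linarith) _).trans_le hq
  have h1 : 2 * M ≤ q ^ (ε / 2) := by
    have := Real.rpow_le_rpow (Real.rpow_nonneg (by linarith) _) hq (half_pos hε).le
    rwa [← Real.rpow_mul (by linarith), div_mul_div_cancel₀ hε.ne', div_self two_ne_zero,
      Real.rpow_one] at this
  have h2 : q ^ (ε / 2) * q ^ (1 - ε / 2) = q := by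
    rw [← Real.rpow_add h0]; simp
  have h3 := Real.rpow_nonneg h0.le (1 - ε / 2)
  nlinarith

theorem letterMatrix_inv_mul {d : ℕ} {H₁ H₂ : Subgroup SL(d, ℝ)} (x : H₁ ⊕ H₂) :
    letterMatrix (x.map (·⁻¹) (·⁻¹)) * letterMatrix x = 1 := by
  have key (g : SL(d, ℝ)) : (g⁻¹).1 * g.1 = 1 := by
    rw [← Matrix.SpecialLinearGroup.coe_mul, inv_mul_cancel, Matrix.SpecialLinearGroup.coe_one]
  rcases x with x | x <;> exact key x.1

theorem prod_singularRatio_le {d : ℕ} (hd : 0 < d) {H₁ H₂ : Subgroup SL(d, ℝ)}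
    (w : List (H₁ ⊕ H₂)) {ε : ℝ} (hε : ε < 1) :
    (w.map fun x => singularRatio (letterMatrix x) ^ (2 - ε)).prod ≤
      (w.map fun x => (‖letterMatrix x‖ ^ 2) ^ (1 - ε / 2)).prod *
        ((invWord w).map fun x => (‖letterMatrix x‖ ^ 2) ^ (1 - ε / 2)).prod := by
  rw [invWord, List.map_reverse, List.prod_reverse, List.map_map, ← List.prod_map_mul]
  refine List.prod_map_le_prod_map₀ _ _ (fun x _ => Real.rpow_nonneg (singularRatio_nonneg _) _)
    fun x _ => ?_
  have h := singularRatio_le_frobenius hd (letterMatrix_inv_mul x)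
  have key (a : ℝ) (ha : 0 ≤ a) : (a ^ 2) ^ (1 - ε / 2) = a ^ (2 - ε) := by
    rw [← Real.rpow_natCast, ← Real.rpow_mul ha]; congr 1; push_cast; ring
  rw [Function.comp_apply, key _ (norm_nonneg _), key _ (norm_nonneg _),
    ← Real.mul_rpow (norm_nonneg _) (norm_nonneg _)]
  exact Real.rpow_le_rpow (singularRatio_nonneg _) h (by linarith)

/-- The properties of the representation for a fixed `ε`, in any basis. -/
theorem exists_subgroups_pingPongRep {d r m : ℕ} (hd : 0 < d)
    (b : Module.Basis (Fin m) ℝ (Matrix (Fin d) (Fin d) ℝ × ℝ × (Fin r → ℝ)))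
    (Γ₁ Γ₂ : Subgroup SL(d, ℝ)) (h₁ : Γ₁.FG) (h₂ : Γ₂.FG) [DiscreteTopology Γ₁]
    [DiscreteTopology Γ₂] {ε : ℝ} (hε : 0 < ε) (hε1 : ε < 1) :
    ∃ H₁ H₂ : Subgroup SL(d, ℝ),
      H₁ ≤ Γ₁ ∧ H₂ ≤ Γ₂ ∧ H₁.IsFiniteRelIndex Γ₁ ∧ H₂.IsFiniteRelIndex Γ₂ ∧
      IsDiscreteFaithful (restrictCoprod (matrixRep b (pingPongRep hd r)) H₁ H₂) ∧
      ∀ w : List (H₁ ⊕ H₂), IsReducedWord w →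
        (w.map fun x => singularRatio (letterMatrix x) ^ (2 - ε)).prod ≤
          singularRatio
            (restrictCoprod (matrixRep b (pingPongRep hd r)) H₁ H₂ (wordProd w)).val := by
  obtain ⟨u, hu, K, hK, hgrow⟩ := exists_pingPongRep_growth (r := r) hd b
  have hM : 1 ≤ 2 * K := by linarith
  -- the threshold absorbs the constant `K` and the factors `1 / 2` of the letters into `ε`
  set Q : ℝ := max (max 1 (4 * d)) ((2 * (2 * K)) ^ (2 / ε)) with hQ
  obtain ⟨H₁, hH₁, hf₁, hl₁⟩ := exists_isFiniteRelIndex_frobenius_large Γ₁ h₁ Q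
  obtain ⟨H₂, hH₂, hf₂, hl₂⟩ := exists_isFiniteRelIndex_frobenius_large Γ₂ h₂ Q
  have hlarge (w : List (H₁ ⊕ H₂)) (hw : IsReducedWord w) (y) (hy : y ∈ w) :
      Q ≤ ‖letterMatrix y‖ ^ 2 := by
    have := hw.1 y hy
    rcases y with y | y
    · exact hl₁ y.1 y.2 fun h => this.1 (congrArg Sum.inl (Subtype.ext h))
    · exact hl₂ y.1 y.2 fun h => this.2 (congrArg Sum.inr (Subtype.ext h))
  have hgrow' (w : List (H₁ ⊕ H₂)) (hne : w ≠ []) (hw : IsReducedWord w) :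
      ∃ l, 2 * (w.map fun y => (‖letterMatrix y‖ ^ 2) ^ (1 - ε / 2)).prod * ‖u l‖ ≤
        ‖(restrictCoprod (matrixRep b (pingPongRep hd r)) H₁ H₂
          (wordProd w)).val.toEuclideanLin (u l)‖ := by
    obtain ⟨l, hl⟩ := hgrow H₁ H₂ w hne hw fun y hy =>
      ((le_max_right _ _).trans (le_max_left _ _)).trans (hlarge w hw y hy)
    refine ⟨l, le_trans ?_ hl⟩
    gcongr
    rw [le_div_iff₀ (by positivity)]
    have := prod_rpow_le_prod_half (q := fun y => ‖letterMatrix y‖ ^ 2) (s := 1 - ε / 2) hM hne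
      fun y hy => ⟨sq_nonneg _, mul_rpow_le_half hε hM
        ((le_max_right _ _).trans (hlarge w hw y hy))⟩
    linarith
  have hone (w : List (H₁ ⊕ H₂)) (hw : IsReducedWord w) :
      1 ≤ (w.map fun y => (‖letterMatrix y‖ ^ 2) ^ (1 - ε / 2)).prod := by
    have := List.prod_map_le_prod_map₀ (s := w) (fun _ => (1 : ℝ))
      (fun y => (‖letterMatrix y‖ ^ 2) ^ (1 - ε / 2)) (fun _ _ => zero_le_one) fun y hy =>
        Real.one_le_rpow (((le_max_left _ _).trans (le_max_left _ _)).trans (hlarge w hw y hy))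
          (by linarith)
    simpa using this
  refine ⟨H₁, H₂, hH₁, hH₂, hf₁, hf₂, ?_, fun w hw => ?_⟩
  · refine isDiscreteFaithful_of_expanding _ u hu fun g hg => ?_
    obtain ⟨w, hw, rfl⟩ := exists_isReducedWord g
    obtain ⟨l, hl⟩ := hgrow' w (by rintro rfl; exact hg rfl) hw
    refine ⟨l, le_trans ?_ hl⟩
    gcongr
    linarith [hone w hw]
  · have hinv := hw.invWord
    refine (prod_singularRatio_le hd w hε1).trans ?_
    set p := (w.map fun y => (‖letterMatrix y‖ ^ 2) ^ (1 - ε / 2)).prod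
    set p' := ((invWord w).map fun y => (‖letterMatrix y‖ ^ 2) ^ (1 - ε / 2)).prod
    have hp : 1 ≤ p := hone w hw
    have hp' : 1 ≤ p' := hone _ hinv
    -- the smallest singular value is controlled by the growth of the inverse word
    have hAB : (restrictCoprod (matrixRep b (pingPongRep hd r)) H₁ H₂ (wordProd w)).val *
        (restrictCoprod (matrixRep b (pingPongRep hd r)) H₁ H₂ (wordProd (invWord w))).val = 1 := by
      rw [wordProd_invWord, map_inv]
      exact Units.mul_inv _
    have hex (w : List (H₁ ⊕ H₂)) (hw : IsReducedWord w) :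
        ∃ l, (w.map fun y => (‖letterMatrix y‖ ^ 2) ^ (1 - ε / 2)).prod * ‖u l‖ ≤
          ‖(restrictCoprod (matrixRep b (pingPongRep hd r)) H₁ H₂
            (wordProd w)).val.toEuclideanLin (u l)‖ := by
      by_cases hne : w = []
      · subst hne
        refine ⟨true, le_of_eq ?_⟩
        simp [wordProd]
      · obtain ⟨l, hl⟩ := hgrow' w hne hw
        refine ⟨l, le_trans ?_ hl⟩
        gcongr
        linarith [hone w hw]
    obtain ⟨l, hl⟩ := hex w hw
    obtain ⟨l', hl'⟩ := hex _ hinv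
    exact le_singularRatio hAB (hu l) (hu l') (by linarith) hl hl'

end Growth

theorem theorem1p6 (d : ℕ) (hd : 2 ≤ d) :
    ∃ ρ : Monoid.Coprod SL(d, ℝ) SL(d, ℝ) →* GL (Fin (d ^ 2 * (d + 1) ^ 2 / 4 + 1)) ℝ,
      ∀ Γ₁ Γ₂ : Subgroup SL(d, ℝ), Γ₁.FG → Γ₂.FG → DiscreteTopology Γ₁ → DiscreteTopology Γ₂ →
        (∃ H₁ H₂ : Subgroup SL(d, ℝ),
          H₁ ≤ Γ₁ ∧ H₂ ≤ Γ₂ ∧ H₁.IsFiniteRelIndex Γ₁ ∧ H₂.IsFiniteRelIndex Γ₂ ∧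
          IsDiscreteFaithful (restrictCoprod ρ H₁ H₂)) ∧
        ∀ ε : ℝ, 0 < ε → ε < 1 →
          ∃ H₁ H₂ : Subgroup SL(d, ℝ),
            H₁ ≤ Γ₁ ∧ H₂ ≤ Γ₂ ∧ H₁.IsFiniteRelIndex Γ₁ ∧ H₂.IsFiniteRelIndex Γ₂ ∧
            IsDiscreteFaithful (restrictCoprod ρ H₁ H₂) ∧
            ∀ w : List (H₁ ⊕ H₂), IsReducedWord w →
              (w.map fun x => singularRatio (letterMatrix x) ^ (2 - ε)).prod ≤
                singularRatio
                  (restrictCoprod ρ H₁ H₂ (wordProd w)).val := by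
  have hd0 : 0 < d := by omega
  -- `d ^ 2 + 1` dimensions carry the ping-pong, and the action on the others is trivial
  have hle : d ^ 2 ≤ d ^ 2 * (d + 1) ^ 2 / 4 := by
    rw [Nat.le_div_iff_mul_le (by norm_num)]
    gcongr
    nlinarith
  obtain ⟨r, hr⟩ := Nat.exists_eq_add_of_le hle
  have hdim : Module.finrank ℝ (Matrix (Fin d) (Fin d) ℝ × ℝ × (Fin r → ℝ)) =
      d ^ 2 * (d + 1) ^ 2 / 4 + 1 := by
    rw [Module.finrank_prod, Module.finrank_prod, Module.finrank_matrix, Module.finrank_self,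
      Module.finrank_fin_fun, Fintype.card_fin, hr]
    ring
  let b := Module.finBasisOfFinrankEq ℝ (Matrix (Fin d) (Fin d) ℝ × ℝ × (Fin r → ℝ)) hdim
  refine ⟨matrixRep b (pingPongRep hd0 r), fun Γ₁ Γ₂ h₁ h₂ _ _ => ⟨?_, fun ε hε hε1 =>
    exists_subgroups_pingPongRep hd0 b Γ₁ Γ₂ h₁ h₂ hε hε1⟩⟩
  obtain ⟨H₁, H₂, hH₁, hH₂, hf₁, hf₂, h, -⟩ :=
    exists_subgroups_pingPongRep hd0 b Γ₁ Γ₂ h₁ h₂ one_half_pos one_half_lt_one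
  exact ⟨H₁, H₂, hH₁, hH₂, hf₁, hf₂, h⟩
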